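/- Let $n\ge 1$ and let $\Gamma:\mathbb R^n\to\mathbb R^{n\times n}$ and $b:\mathbb R^n\to\mathbb R^n$ be $C^\infty$ and $1$-periodic in each coordinate, with $\Gamma(x)$ invertible for every $x$. Put $D=\tfrac12\Gamma\Gamma^T$. Consider the diffusion $dX=\Gamma(X)\,dB+b(X)\,dt$ on $\mathbb R^n$ (the lift of the corresponding diffusion on the torus $\mathbb T^n$), whose law at time $t>0$ has a density $f(\cdot,t)$ that is a non-negative classical solution of the Kolmogorov forward equation $$\partial_t f=-\nabla\cdot(bf)+\nabla\cdot\nabla\cdot(Df).$$ A measure $\mu$ is called stationary if it has density $f(\cdot,t)$ for all $t>0$, for some such solution $f$ of the forward equation. A stationary density is a non-negative $C^2$ function $p$, not necessarily integrable, with $-\nabla\cdot(bp)+\nabla\cdot\nabla\cdot(Dp)=0$. For a function $g$ let $J_g=\nabla\cdot(Dg)-bg$. Then: 1. The diffusion has no stationary probability distribution: no probability measure on $\mathbb R^n$ is stationary. 2. Let $\rho$ be a $1$-periodic stationary density with $\int_{[0,1)^n}\rho\,dx=1$, that is, the periodic continuation of a stationary probability density of the diffusion on $\mathbb T^n$. Then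 $\rho$ is not integrable on $\mathbb R^n$, and every stationary density $p$ for which the boundary terms at infinity vanish, namely for which the fluxes of the fields $\log(p/\rho)\,J_p$ and $(p/\rho)\,J_\rho$ through the boundary of the cube $[-R,R]^n$ tend to $0$ as $R\to\infty$, satisfies $p=c\rho$ for some constant $c$. -/

import Mathlib

open MeasureTheory Filter Topology
open scoped ContDiff

noncomputable section

namespace LiftedDiffusion

/-- The space `ℝⁿ` with `n = d + 1 ≥ 1` (only its smooth structure and Lebesgue measure matter). -/
abbrev Space (d : ℕ) : Type := Fin (d + 1) → ℝ

/-- The partial derivative `∂g/∂xᵢ` at `x`. -/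
def pderiv {d : ℕ} (i : Fin (d + 1)) (g : Space d → ℝ) (x : Space d) : ℝ :=
  fderiv ℝ g x (Pi.single i 1)

/-- The divergence `∑ᵢ ∂Vᵢ/∂xᵢ` of a vector field. -/
def divergence {d : ℕ} (V : Space d → Space d) (x : Space d) : ℝ :=
  ∑ i, pderiv i (fun y => V y i) x

/-- The row-wise divergence of a matrix field: its `i`-th component is `∑ⱼ ∂Mᵢⱼ/∂xⱼ`. -/
def matrixDivergence {d : ℕ} (M : Space d → Matrix (Fin (d + 1)) (Fin (d + 1)) ℝ)
    (x : Space d) : Space d :=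
  fun i => divergence (fun y => M y i) x

/-- A function on `ℝⁿ` that has period `1` in each coordinate. -/
def IsOnePeriodic {d : ℕ} {α : Type*} (g : Space d → α) : Prop :=
  ∀ (i : Fin (d + 1)) (x : Space d), g (x + Pi.single i 1) = g x

/-- The coefficients of the lifted diffusion `dX = Γ(X) dB + b(X) dt` on `ℝⁿ`: smooth,
`1`-periodic in each coordinate, with `Γ` everywhere non-degenerate. -/
structure PeriodicDiffusion (d : ℕ) where
  Γ : Space d → Matrix (Fin (d + 1)) (Fin (d + 1)) ℝ
  b : Space d → Space d
  smooth_Γ : ∀ i j, ContDiff ℝ ∞ (fun x => Γ x i j)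
  smooth_b : ContDiff ℝ ∞ b
  periodic_Γ : IsOnePeriodic Γ
  periodic_b : IsOnePeriodic b
  nondegenerate : ∀ x, (Γ x).det ≠ 0

namespace PeriodicDiffusion

variable {d : ℕ} (X : PeriodicDiffusion d)

/-- The diffusion matrix `D = ½ Γ Γᵀ`. -/
def D (x : Space d) : Matrix (Fin (d + 1)) (Fin (d + 1)) ℝ :=
  (1 / 2 : ℝ) • (X.Γ x * (X.Γ x).transpose)

/-- The field `J_g = ∇·(D g) - b g`. -/
def J (g : Space d → ℝ) (x : Space d) : Space d :=
  matrixDivergence (fun y => g y • X.D y) x - g x • X.b x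

/-- The Kolmogorov forward operator `g ↦ -∇·(b g) + ∇·∇·(D g)`. -/
def forwardOp (g : Space d → ℝ) (x : Space d) : ℝ :=
  -divergence (fun y => g y • X.b y) x
    + divergence (matrixDivergence (fun y => g y • X.D y)) x

/-- `f t x` is a non-negative classical solution, for `t > 0`, of the Kolmogorov forward
equation `∂f/∂t = -∇·(b f) + ∇·∇·(D f)`. -/
def IsForwardSolution (f : ℝ → Space d → ℝ) : Prop :=
  ∀ t : ℝ, 0 < t → ContDiff ℝ 2 (f t) ∧ ∀ x, 0 ≤ f t x ∧
    HasDerivAt (fun s => f s x) (X.forwardOp (f t) x) t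

/-- The measure `μ` is stationary: the law with density `f(·, t)`, evolving by the Kolmogorov
forward equation, is equal to `μ` at all times. -/
def IsStationaryMeasure (μ : Measure (Space d)) : Prop :=
  ∃ f : ℝ → Space d → ℝ, X.IsForwardSolution f ∧
    ∀ t : ℝ, 0 < t → volume.withDensity (fun x => ENNReal.ofReal (f t x)) = μ

/-- `p` is a (not necessarily normalizable) stationary density: a non-negative `C²` function
with `-∇·(b p) + ∇·∇·(D p) = 0`. -/
def IsStationaryDensity (p : Space d → ℝ) : Prop :=
  ContDiff ℝ 2 p ∧ ∀ x, 0 ≤ p x ∧ X.forwardOp p x = 0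

/-- `ρ` is the `1`-periodic continuation to `ℝⁿ` of a stationary probability density of the
folded diffusion on the torus `[0,1)ⁿ`. -/
def IsPeriodicStationaryDensity (ρ : Space d → ℝ) : Prop :=
  X.IsStationaryDensity ρ ∧ IsOnePeriodic ρ ∧
    ∫ x in Set.univ.pi (fun _ : Fin (d + 1) => Set.Ico (0 : ℝ) 1), ρ x = 1

end PeriodicDiffusion

/-- The outward flux of the vector field `W` through the boundary of the cube `[-R, R]ⁿ`. -/
def boundaryFlux {d : ℕ} (W : Space d → Space d) (R : ℝ) : ℝ :=
  ∑ i : Fin (d + 1),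
    ((∫ y in Set.Icc (fun _ : Fin d => -R) (fun _ : Fin d => R), W (i.insertNth R y) i)
      - ∫ y in Set.Icc (fun _ : Fin d => -R) (fun _ : Fin d => R), W (i.insertNth (-R) y) i)

/-- The integral of `W` over the boundary of `ℝⁿ` is `0`. -/
def VanishesAtBoundary {d : ℕ} (W : Space d → Space d) : Prop :=
  Tendsto (boundaryFlux W) atTop (𝓝 0)

/-- The boundary terms in the time derivative of the relative entropy `∫ p log (p / ν)` all
vanish: those of the fields `log (p / ν) J_p` and `(p / ν) J_ν`. -/
def PeriodicDiffusion.BoundaryTermsVanish {d : ℕ} (X : PeriodicDiffusion d)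
    (p ν : Space d → ℝ) : Prop :=
  VanishesAtBoundary (fun x => Real.log (p x / ν x) • X.J p x) ∧
    VanishesAtBoundary (fun x => (p x / ν x) • X.J ν x)

end LiftedDiffusion

end

open LiftedDiffusion

/-! Write the forward operator as `L g = ∇·J_g`. Everything rests on the identity `J_p = u J_m + m
D∇u` for `u = p/m`, where `m > 0`: it turns convex functionals of a ratio of stationary densities
into the dissipation `∇u·D∇u`. As `D` is positive definite, zero dissipation forces `u` to be
constant. Ratios and logarithms make sense because a stationary density is either identically zero
or everywhere positive (`IsStationaryDensity.eq_zero_of_apply_eq_zero`).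

Uniqueness up to a factor uses relative entropy: with `u = p/ρ`, `∇·(log u J_p) - ∇·(u J_ρ) = (ρ/u)
∇u·D∇u ≥ 0`. Integrated over growing cubes, the left side is a difference of boundary fluxes tending
to `0`.

Non-existence needs no condition at infinity. Let `p` be an integrable nonzero stationary density,
`q` its translate by a unit coordinate vector, `m = p + q` and `s = p/m`. Then `F = s p ≤ p` is
integrable and `L F = 2 m ∇s·D∇s ≥ 0`. Testing against cutoffs of scale `R` bounds the integral of
`L F` by `O(1/R)`, because the periodic coefficients are bounded; hence `L F = 0`, `s` is constant,
and equal masses give `p = q`. So `p` is periodic, continuous and positive, which contradicts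
integrability. -/

namespace LiftedDiffusion

/-! ### Calculus of partial derivatives and divergences. -/

section Calculus

variable {d : ℕ} {i : Fin (d + 1)} {f g : Space d → ℝ} {x : Space d}

lemma pderiv_mul (hf : DifferentiableAt ℝ f x) (hg : DifferentiableAt ℝ g x) :
    pderiv i (fun y => f y * g y) x = f x * pderiv i g x + g x * pderiv i f x := by
  simp [pderiv, fderiv_fun_mul hf hg]

lemma pderiv_add (hf : DifferentiableAt ℝ f x) (hg : DifferentiableAt ℝ g x) :
    pderiv i (fun y => f y + g y) x = pderiv i f x + pderiv i g x := by
  simp [pderiv, fderiv_fun_add hf hg]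

lemma pderiv_sub (hf : DifferentiableAt ℝ f x) (hg : DifferentiableAt ℝ g x) :
    pderiv i (fun y => f y - g y) x = pderiv i f x - pderiv i g x := by
  simp [pderiv, fderiv_fun_sub hf hg]

lemma pderiv_const_mul (c : ℝ) (hf : DifferentiableAt ℝ f x) :
    pderiv i (fun y => c * f y) x = c * pderiv i f x := by
  simp [pderiv, fderiv_const_mul hf]

lemma pderiv_const (c : ℝ) : pderiv i (fun _ : Space d => c) x = 0 := by
  simp [pderiv]

lemma pderiv_sum {ι : Type*} {s : Finset ι} {F : ι → Space d → ℝ}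
    (hF : ∀ j ∈ s, DifferentiableAt ℝ (F j) x) :
    pderiv i (fun y => ∑ j ∈ s, F j y) x = ∑ j ∈ s, pderiv i (F j) x := by
  simp [pderiv, fderiv_fun_sum hF]

lemma pderiv_comp {φ : ℝ → ℝ} {φ' : ℝ} (hφ : HasDerivAt φ φ' (f x)) (hf : DifferentiableAt ℝ f x) :
    pderiv i (fun y => φ (f y)) x = φ' * pderiv i f x := by
  have h := (hφ.comp_hasFDerivAt x hf.hasFDerivAt).fderiv
  simp only [Function.comp_def] at h
  simp [pderiv, h]

lemma fderiv_apply_eq_sum_pderiv (v : Space d) : fderiv ℝ g x v = ∑ j, v j * pderiv j g x := by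
  conv_lhs => rw [pi_eq_sum_univ' v]
  simp [pderiv, map_sum]

lemma contDiff_pderiv {m n : ℕ∞ω} (hg : ContDiff ℝ n g) (hmn : m + 1 ≤ n) :
    ContDiff ℝ m (pderiv i g) :=
  (hg.fderiv_right hmn).clm_apply contDiff_const

lemma continuous_pderiv (hg : ContDiff ℝ 1 g) : Continuous (pderiv i g) :=
  (contDiff_pderiv (m := 0) hg (by simp)).continuous

lemma contDiff_one_pderiv (hg : ContDiff ℝ 2 g) : ContDiff ℝ 1 (pderiv i g) :=
  contDiff_pderiv hg (by norm_num)

lemma divergence_mul {V : Space d → Space d} (hf : DifferentiableAt ℝ f x)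
    (hV : ∀ i, DifferentiableAt ℝ (fun y => V y i) x) :
    divergence (fun y => f y • V y) x
      = f x * divergence V x + ∑ i, V x i * pderiv i f x := by
  simp only [divergence, Pi.smul_apply, smul_eq_mul]
  rw [Finset.mul_sum, ← Finset.sum_add_distrib]
  exact Finset.sum_congr rfl fun i _ => pderiv_mul hf (hV i)

lemma continuous_divergence {V : Space d → Space d} (hV : ∀ i, ContDiff ℝ 1 (fun y => V y i)) :
    Continuous (divergence V) :=
  continuous_finsetSum _ fun i _ => continuous_pderiv (hV i)

lemma exists_eq_const_of_pderiv_eq_zero (hg : Differentiable ℝ g)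
    (h : ∀ x i, pderiv i g x = 0) : ∃ c, ∀ x, g x = c := by
  refine ⟨g 0, fun x => is_const_of_fderiv_eq_zero hg (fun y => ?_) x 0⟩
  ext v
  simp [fderiv_apply_eq_sum_pderiv, h]

end Calculus

/-! ### Ellipticity of `D`, the field `J`, and the forward operator. -/

namespace PeriodicDiffusion

variable {d : ℕ} (X : PeriodicDiffusion d)

lemma D_apply (x : Space d) (i j : Fin (d + 1)) :
    X.D x i j = 1 / 2 * ∑ k, X.Γ x i k * X.Γ x j k := by
  simp [D, Matrix.mul_apply]

lemma contDiff_D (i j : Fin (d + 1)) : ContDiff ℝ ∞ (fun x => X.D x i j) := by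
  simp only [D_apply]
  exact contDiff_const.mul (ContDiff.sum fun k _ => (X.smooth_Γ i k).mul (X.smooth_Γ j k))

lemma contDiff_b (i : Fin (d + 1)) : ContDiff ℝ ∞ (fun x => X.b x i) :=
  contDiff_pi.1 X.smooth_b i

lemma sum_D_mul_mul (x v w : Space d) :
    ∑ i, v i * ∑ j, X.D x i j * w j
      = 1 / 2 * ∑ k, (∑ i, X.Γ x i k * v i) * (∑ i, X.Γ x i k * w i) := by
  simp only [D_apply, Finset.mul_sum, Finset.sum_mul]
  rw [Finset.sum_congr rfl fun i _ => Finset.sum_comm, Finset.sum_comm]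
  refine Finset.sum_congr rfl fun k _ => ?_
  rw [Finset.sum_comm]
  exact Finset.sum_congr rfl fun i _ => Finset.sum_congr rfl fun j _ => by ring

lemma sum_D_mul_self_nonneg (x v : Space d) : 0 ≤ ∑ i, v i * ∑ j, X.D x i j * v j := by
  rw [sum_D_mul_mul]
  exact mul_nonneg (by norm_num) (Finset.sum_nonneg fun k _ => mul_self_nonneg _)

/-- The form is half the squared length of `Γᵀv`, so its vanishing puts `v` in the kernel of the
invertible `Γᵀ`. -/
lemma eq_zero_of_sum_D_mul_self {x v : Space d} (h : ∑ i, v i * ∑ j, X.D x i j * v j = 0) :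
    v = 0 := by
  rw [sum_D_mul_mul] at h
  have h0 : ∑ k, (∑ i, X.Γ x i k * v i) * (∑ i, X.Γ x i k * v i) = 0 := by linarith
  rw [Finset.sum_eq_zero_iff_of_nonneg fun k _ => mul_self_nonneg _] at h0
  refine Matrix.eq_zero_of_vecMul_eq_zero (X.nondegenerate x) (funext fun k => ?_)
  have := mul_self_eq_zero.1 (h0 k (Finset.mem_univ k))
  simpa [Matrix.vecMul, dotProduct, mul_comm] using this

variable {X}

lemma J_apply (g : Space d → ℝ) (x : Space d) (i : Fin (d + 1)) :
    X.J g x i = ∑ j, pderiv j (fun y => g y * X.D y i j) x - g x * X.b x i := by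
  simp [J, matrixDivergence, divergence]

/-- `J` is first order, so moving a factor `g` outside costs only the term `h D∇g`; this is the
source of every dissipation identity below. -/
lemma J_mul {g h : Space d → ℝ} {x : Space d} (hg : DifferentiableAt ℝ g x)
    (hh : DifferentiableAt ℝ h x) (i : Fin (d + 1)) :
    X.J (fun y => g y * h y) x i
      = g x * X.J h x i + h x * ∑ j, X.D x i j * pderiv j g x := by
  have hD : ∀ j, DifferentiableAt ℝ (fun y => X.D y i j) x := fun j =>
    (X.contDiff_D i j).differentiable (by simp) x
  simp only [J_apply, mul_assoc]
  rw [Finset.sum_congr rfl fun j _ => pderiv_mul hg (hh.fun_mul (hD j)), Finset.sum_add_distrib,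
    mul_sub, Finset.mul_sum, Finset.mul_sum]
  simp only [mul_assoc]
  ring

lemma J_eq {g : Space d → ℝ} {x : Space d} (hg : DifferentiableAt ℝ g x) (i : Fin (d + 1)) :
    X.J g x i = g x * X.J (fun _ => 1) x i + ∑ j, X.D x i j * pderiv j g x := by
  simpa using J_mul (X := X) hg (differentiableAt_const (1 : ℝ)) i

lemma contDiff_J_one (i : Fin (d + 1)) : ContDiff ℝ ∞ (fun x => X.J (fun _ => 1) x i) := by
  simp only [J_apply, one_mul]
  exact (ContDiff.sum fun j _ => contDiff_pderiv (X.contDiff_D i j) (by simp)).sub (X.contDiff_b i)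

lemma contDiff_J {g : Space d → ℝ} (hg : ContDiff ℝ 2 g) (i : Fin (d + 1)) :
    ContDiff ℝ 1 (fun x => X.J g x i) := by
  simp only [fun x => J_eq (X := X) (hg.differentiable (by simp) x) i]
  exact ((hg.of_le (by norm_num)).mul ((contDiff_J_one i).of_le (by simp))).add
    (ContDiff.sum fun j _ => ((X.contDiff_D i j).of_le (by simp)).mul (contDiff_one_pderiv hg))

lemma differentiable_J {g : Space d → ℝ} (hg : ContDiff ℝ 2 g) (i : Fin (d + 1)) :
    Differentiable ℝ (fun x => X.J g x i) :=
  (contDiff_J hg i).differentiable (by simp)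

lemma forwardOp_eq_divergence_J {g : Space d → ℝ} (hg : ContDiff ℝ 2 g) (x : Space d) :
    X.forwardOp g x = divergence (X.J g) x := by
  have hb : ∀ i, Differentiable ℝ (fun y => g y * X.b y i) := fun i =>
    (hg.differentiable (by simp)).mul ((X.contDiff_b i).differentiable (by simp))
  have hM : ∀ i, Differentiable ℝ
      (fun y => matrixDivergence (fun y => g y • X.D y) y i) := fun i => by
    have h : (fun y => matrixDivergence (fun y => g y • X.D y) y i) =
        fun y => X.J g y i + g y * X.b y i := funext fun y => by simp [J]
    exact h ▸ (differentiable_J (X := X) hg i).fun_add (hb i)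
  simp only [forwardOp, divergence, Pi.smul_apply, smul_eq_mul]
  rw [neg_add_eq_sub, ← Finset.sum_sub_distrib]
  refine Finset.sum_congr rfl fun i _ => ?_
  rw [← pderiv_sub (hM i x) (hb i x)]
  rfl

lemma continuous_forwardOp {g : Space d → ℝ} (hg : ContDiff ℝ 2 g) :
    Continuous (X.forwardOp g) := by
  rw [funext (forwardOp_eq_divergence_J hg)]
  exact continuous_divergence (contDiff_J hg)

variable (X) in
/-- The expanded, non-divergence form of the forward operator. -/
lemma exists_forwardOp_eq : ∃ (B : Space d → Space d) (c : Space d → ℝ),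
    Continuous B ∧ Continuous c ∧ ∀ g, ContDiff ℝ 2 g → ∀ x, X.forwardOp g x =
      ∑ i, ∑ j, X.D x i j * pderiv i (pderiv j g) x + ∑ i, B x i * pderiv i g x + c x * g x := by
  -- Expand `∇·(g J_1 + D∇g)`: the first-order terms collect `J_1` and the column divergences of
  -- `D`, and the zeroth-order coefficient is `∇·J_1`.
  refine ⟨fun x j => X.J (fun _ => 1) x j + ∑ i, pderiv i (fun y => X.D y i j) x,
    fun x => ∑ i, pderiv i (fun y => X.J (fun _ => 1) y i) x, ?_, ?_, fun g hg x => ?_⟩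
  · exact continuous_pi fun j => (contDiff_J_one j).continuous.add <|
      continuous_finsetSum _ fun i _ => continuous_pderiv ((X.contDiff_D i j).of_le (by simp))
  · exact continuous_finsetSum _ fun i _ => continuous_pderiv ((contDiff_J_one i).of_le (by simp))
  · have hd := hg.differentiable (by simp)
    have hD : ∀ i j, Differentiable ℝ (fun y => X.D y i j) := fun i j =>
      (X.contDiff_D i j).differentiable (by simp)
    have hJ : ∀ i, Differentiable ℝ (fun y => X.J (fun _ => 1) y i) := fun i =>
      (contDiff_J_one i).differentiable (by simp)
    have hp : ∀ i, Differentiable ℝ (pderiv i g) := fun i =>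
      (contDiff_one_pderiv hg).differentiable (by simp)
    have key : ∀ i, pderiv i (fun y => X.J g y i) x =
        ∑ j, X.D x i j * pderiv i (pderiv j g) x
          + (X.J (fun _ => 1) x i * pderiv i g x
            + ∑ j, pderiv i (fun y => X.D y i j) x * pderiv j g x)
          + pderiv i (fun y => X.J (fun _ => 1) y i) x * g x := fun i => by
      simp only [fun y => J_eq (X := X) (hd y) i]
      rw [pderiv_add ((hd x).fun_mul (hJ i x))
        (DifferentiableAt.fun_sum fun j _ => (hD i j x).fun_mul (hp j x)), pderiv_mul (hd x) (hJ i x),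
        pderiv_sum fun j _ => (hD i j x).fun_mul (hp j x),
        Finset.sum_congr rfl fun j _ => pderiv_mul (hD i j x) (hp j x), Finset.sum_add_distrib]
      simp only [mul_comm (pderiv _ g x)]
      ring
    rw [forwardOp_eq_divergence_J hg, divergence, Finset.sum_congr rfl fun i _ => key i]
    simp only [add_mul, Finset.sum_add_distrib, Finset.sum_mul]
    rw [Finset.sum_comm (f := fun i j => pderiv i (fun y => X.D y i j) x * pderiv j g x)]

end PeriodicDiffusion

end LiftedDiffusion

/-! ### Second-order conditions at a minimum, and Gaussian barriers. -/

lemma IsLocalMin.deriv_deriv_nonneg {f : ℝ → ℝ} {a : ℝ} (h : IsLocalMin f a)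
    (hf : ContinuousAt f a) : 0 ≤ deriv (deriv f) a := by
  by_contra! hlt
  -- A negative second derivative would make `a` a local maximum too, hence `f` locally constant
  -- with second derivative zero.
  have hmax := isLocalMax_of_deriv_deriv_neg hlt h.deriv_eq_zero hf
  have hconst : f =ᶠ[𝓝 a] fun _ => f a := by
    filter_upwards [h, hmax] with x h1 h2 using le_antisymm h2 h1
  have := hconst.deriv.deriv_eq
  simp at this
  linarith

namespace LiftedDiffusion

section Barrier

variable {d : ℕ}

lemma _root_.IsLocalMin.pderiv_eq_zero {g : Space d → ℝ} {m : Space d} (h : IsLocalMin g m)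
    (i : Fin (d + 1)) : pderiv i g m = 0 := by
  simp [pderiv, h.fderiv_eq_zero]

lemma sum_mul_pderiv_pderiv_nonneg {g : Space d → ℝ} (hg : ContDiff ℝ 2 g) {m : Space d}
    (h : IsLocalMin g m) (v : Space d) : 0 ≤ ∑ i, ∑ j, v i * v j * pderiv i (pderiv j g) m := by
  have hline : ∀ t : ℝ, HasDerivAt (fun t : ℝ => m + t • v) v t := fun t => by
    simpa using ((hasDerivAt_id t).smul_const v).const_add m
  have hcomp : ∀ {k : Space d → ℝ}, Differentiable ℝ k → ∀ t : ℝ,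
      HasDerivAt (fun t : ℝ => k (m + t • v)) (∑ i, v i * pderiv i k (m + t • v)) t :=
    fun hk t => by
      rw [← fderiv_apply_eq_sum_pderiv]
      exact (hk (m + t • v)).hasFDerivAt.comp_hasDerivAt t (hline t)
  have hd := hg.differentiable (by simp)
  have hderiv : deriv (fun t : ℝ => g (m + t • v)) = fun t => ∑ j, v j * pderiv j g (m + t • v) :=
    funext fun t => (hcomp hd t).deriv
  have hmin : IsLocalMin (fun t : ℝ => g (m + t • v)) 0 := by
    have h' : IsLocalMin g (m + (0 : ℝ) • v) := by simpa using h
    exact h'.comp_continuous (g := fun t : ℝ => m + t • v) (b := 0) (hline 0).continuousAt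
  have h2 := hmin.deriv_deriv_nonneg (hcomp hd 0).continuousAt
  rw [hderiv, (HasDerivAt.fun_sum fun j _ => (hcomp ((contDiff_one_pderiv hg).differentiable
    (by simp)) 0).const_mul (v j)).deriv, zero_smul, add_zero] at h2
  rw [Finset.sum_comm]
  refine h2.trans_eq (Finset.sum_congr rfl fun j _ => ?_)
  rw [Finset.mul_sum]
  exact Finset.sum_congr rfl fun i _ => by ring

/-- `D : ∇²g` is half the sum of the second derivatives of `g` along the columns of `Γ`, each
nonnegative at a minimum. -/
lemma PeriodicDiffusion.sum_D_mul_pderiv_pderiv_nonneg (X : PeriodicDiffusion d)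
    {g : Space d → ℝ} (hg : ContDiff ℝ 2 g) {m : Space d} (h : IsLocalMin g m) :
    0 ≤ ∑ i, ∑ j, X.D m i j * pderiv i (pderiv j g) m := by
  have hk : ∀ k, 0 ≤ ∑ i, ∑ j, X.Γ m i k * X.Γ m j k * pderiv i (pderiv j g) m := fun k =>
    sum_mul_pderiv_pderiv_nonneg hg h fun i => X.Γ m i k
  have : ∑ i, ∑ j, X.D m i j * pderiv i (pderiv j g) m
      = 1 / 2 * ∑ k, ∑ i, ∑ j, X.Γ m i k * X.Γ m j k * pderiv i (pderiv j g) m := by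
    simp only [D_apply, Finset.mul_sum, Finset.sum_mul]
    symm
    rw [Finset.sum_comm]
    refine Finset.sum_congr rfl fun i _ => ?_
    rw [Finset.sum_comm]
    exact Finset.sum_congr rfl fun j _ => Finset.sum_congr rfl fun k _ => by ring
  rw [this]
  exact mul_nonneg (by norm_num) (Finset.sum_nonneg fun k _ => hk k)

/-- The squared Euclidean distance. -/
noncomputable def sqDist (y x : Space d) : ℝ := ∑ i, (x i - y i) ^ 2

lemma contDiff_sqDist {n : ℕ∞ω} (y : Space d) : ContDiff ℝ n (sqDist y) :=
  ContDiff.sum fun i _ => ((contDiff_apply ℝ ℝ i).sub contDiff_const).pow 2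

lemma sqDist_nonneg (y x : Space d) : 0 ≤ sqDist y x := Finset.sum_nonneg fun _ _ => sq_nonneg _

lemma sqDist_eq_zero {y x : Space d} : sqDist y x = 0 ↔ x = y := by
  rw [sqDist, Finset.sum_eq_zero_iff_of_nonneg fun _ _ => sq_nonneg _]
  simp [funext_iff, sub_eq_zero]

lemma isCompact_sqDist_le (y : Space d) (T : ℝ) : IsCompact {x | sqDist y x ≤ T} := by
  refine (isCompact_closedBall y √T).of_isClosed_subset
    (isClosed_le (contDiff_sqDist (n := 0) y).continuous continuous_const) fun x hx => ?_
  rw [Metric.mem_closedBall, dist_pi_le_iff (Real.sqrt_nonneg T)]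
  intro i
  rw [Real.dist_eq]
  refine Real.abs_le_sqrt (le_trans ?_ hx)
  exact Finset.single_le_sum (f := fun i => (x i - y i) ^ 2) (fun _ _ => sq_nonneg _)
    (Finset.mem_univ i)

lemma pderiv_apply (i j : Fin (d + 1)) (x : Space d) :
    pderiv i (fun y : Space d => y j) x = if i = j then 1 else 0 := by
  have : fderiv ℝ (fun y : Space d => y j) x = ContinuousLinearMap.proj j :=
    (ContinuousLinearMap.proj (R := ℝ) (φ := fun _ : Fin (d + 1) => ℝ) j).hasFDerivAt.fderiv
  simp [pderiv, this, Pi.single_apply, eq_comm]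

lemma differentiable_sub_apply (y : Space d) (j : Fin (d + 1)) :
    Differentiable ℝ (fun x : Space d => x j - y j) :=
  (differentiable_apply j).sub_const _

lemma pderiv_sub_apply (y : Space d) (i j : Fin (d + 1)) (x : Space d) :
    pderiv i (fun x : Space d => x j - y j) x = if i = j then 1 else 0 := by
  rw [pderiv_sub (differentiable_apply j x) (differentiableAt_const _), pderiv_apply, pderiv_const,
    sub_zero]

lemma pderiv_sqDist (y : Space d) (i : Fin (d + 1)) (x : Space d) :
    pderiv i (sqDist y) x = 2 * (x i - y i) := by
  have h : ∀ j, pderiv i (fun x : Space d => (x j - y j) ^ 2) x =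
      if i = j then 2 * (x j - y j) else 0 := fun j => by
    simp only [sq]
    rw [pderiv_mul (differentiable_sub_apply y j x) (differentiable_sub_apply y j x),
      pderiv_sub_apply]
    split_ifs <;> ring
  unfold sqDist
  rw [pderiv_sum fun j _ => (differentiable_sub_apply y j x).fun_pow 2,
    Finset.sum_congr rfl fun j _ => h j]
  simp

/-- The Gaussian profile used as a barrier. -/
noncomputable def gaussianBump (α : ℝ) (y x : Space d) : ℝ := Real.exp (-α * sqDist y x)

lemma contDiff_gaussianBump {n : ℕ∞ω} (α : ℝ) (y : Space d) : ContDiff ℝ n (gaussianBump α y) :=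
  (contDiff_const.mul (contDiff_sqDist y)).exp

lemma differentiable_gaussianBump (α : ℝ) (y : Space d) : Differentiable ℝ (gaussianBump α y) :=
  (contDiff_gaussianBump (n := 1) α y).differentiable (by simp)

lemma pderiv_gaussianBump (α : ℝ) (y : Space d) (i : Fin (d + 1)) (x : Space d) :
    pderiv i (gaussianBump α y) x = -2 * α * ((x i - y i) * gaussianBump α y x) := by
  have h : HasDerivAt (fun t => Real.exp (-α * t)) (Real.exp (-α * sqDist y x) * (-α))
      (sqDist y x) := by
    simpa using ((hasDerivAt_id (sqDist y x)).const_mul (-α)).exp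
  have := pderiv_comp (i := i) h ((contDiff_sqDist (n := 1) y).differentiable (by simp) x)
  rw [pderiv_sqDist] at this
  refine this.trans ?_
  rw [gaussianBump]
  ring

lemma pderiv_pderiv_gaussianBump (α : ℝ) (y : Space d) (i j : Fin (d + 1)) (x : Space d) :
    pderiv i (pderiv j (gaussianBump α y)) x =
      (4 * α ^ 2 * ((x i - y i) * (x j - y j)) - 2 * α * if i = j then 1 else 0)
        * gaussianBump α y x := by
  rw [funext (pderiv_gaussianBump α y j), pderiv_const_mul _
    ((differentiable_sub_apply y j x).fun_mul (differentiable_gaussianBump α y x)),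
    pderiv_mul (differentiable_sub_apply y j x) (differentiable_gaussianBump α y x),
    pderiv_sub_apply, pderiv_gaussianBump]
  ring

end Barrier

/-! ### The strong maximum principle. -/

namespace PeriodicDiffusion

variable {d : ℕ} {X : PeriodicDiffusion d}

/-- For large `α` the Gaussian profile is a strict subsolution on a shell around its centre. -/
lemma exists_barrier (X : PeriodicDiffusion d) {B : Space d → Space d} (hB : Continuous B)
    (y : Space d) {T : ℝ} (hT : 0 < T) (K : ℝ) : ∃ α > 0, ∀ x, T / 4 ≤ sqDist y x →
      sqDist y x ≤ T → K * gaussianBump α y x <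
        ∑ i, ∑ j, X.D x i j * pderiv i (pderiv j (gaussianBump α y)) x
          + ∑ i, B x i * pderiv i (gaussianBump α y) x := by
  have hDc : ∀ i j, Continuous fun x => X.D x i j := fun i j => (X.contDiff_D i j).continuous
  have hN : Continuous (sqDist y) := (contDiff_sqDist (n := 0) y).continuous
  set A : Set (Space d) := {x | sqDist y x ≤ T} ∩ {x | T / 4 ≤ sqDist y x} with hA
  have hAc : IsCompact A := (isCompact_sqDist_le y T).inter_right (isClosed_le continuous_const hN)
  set Q : Space d → ℝ := fun x => ∑ i, (x i - y i) * ∑ j, X.D x i j * (x j - y j) with hQ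
  have hQc : Continuous Q := by fun_prop
  set S : Space d → ℝ := fun x => ∑ i, X.D x i i + ∑ i, B x i * (x i - y i) with hS
  have hSc : Continuous S := by fun_prop
  have hQpos : ∀ x ∈ A, 0 < Q x := fun x hx => by
    refine lt_of_le_of_ne (X.sum_D_mul_self_nonneg x fun i => x i - y i) fun h => ?_
    have h0 := X.eq_zero_of_sum_D_mul_self h.symm
    have hxy : sqDist y x = 0 := by
      rw [sqDist_eq_zero]
      exact funext fun i => sub_eq_zero.1 (congrFun h0 i)
    have := hx.2
    simp only [Set.mem_ofPred_eq, hxy] at this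
    linarith
  -- Ellipticity is uniform on the compact shell, which stays away from the centre `y`, the only
  -- zero of `Q`.
  obtain ⟨l, hl, hlQ⟩ : ∃ l > 0, ∀ x ∈ A, l ≤ Q x := by
    rcases A.eq_empty_or_nonempty with hE | hne
    · exact ⟨1, one_pos, by simp [hE]⟩
    · obtain ⟨x, hx, hmin⟩ := hAc.exists_isMinOn hne hQc.continuousOn
      exact ⟨Q x, hQpos x hx, fun z hz => hmin hz⟩
  obtain ⟨E, hE⟩ := hAc.exists_bound_of_continuousOn hSc.continuousOn
  -- The gain `4α²Q` is quadratic in `α` while the loss `2αS` is linear; this `α` makes `αQ` exceed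
  -- `2|E| + |K|` on the shell.
  set α := max 1 ((2 * |E| + |K| + 1) / l) with hα
  have h1 : 1 ≤ α := le_max_left _ _
  have h2 : 2 * |E| + |K| + 1 ≤ α * l := by
    rw [← div_le_iff₀ hl]; exact le_max_right _ _
  refine ⟨α, by linarith, fun x hx1 hx2 => ?_⟩
  have hsum : ∑ i, ∑ j, X.D x i j * pderiv i (pderiv j (gaussianBump α y)) x
      + ∑ i, B x i * pderiv i (gaussianBump α y) x
      = (4 * α ^ 2 * Q x - 2 * α * S x) * gaussianBump α y x := by
    have e1 : ∑ i, ∑ j, X.D x i j * pderiv i (pderiv j (gaussianBump α y)) x =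
        4 * α ^ 2 * gaussianBump α y x * Q x
          - 2 * α * gaussianBump α y x * ∑ i, X.D x i i := by
      simp only [hQ, pderiv_pderiv_gaussianBump, Finset.mul_sum]
      rw [← Finset.sum_sub_distrib]
      refine Finset.sum_congr rfl fun i _ => ?_
      have : ∀ j, X.D x i j * ((4 * α ^ 2 * ((x i - y i) * (x j - y j))
          - 2 * α * if i = j then 1 else 0) * gaussianBump α y x) =
          4 * α ^ 2 * gaussianBump α y x * ((x i - y i) * (X.D x i j * (x j - y j)))
          - if i = j then 2 * α * gaussianBump α y x * X.D x i j else 0 := fun j => by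
        split_ifs <;> ring
      rw [Finset.sum_congr rfl fun j _ => this j, Finset.sum_sub_distrib]
      simp
    have e2 : ∑ i, B x i * pderiv i (gaussianBump α y) x =
        -(2 * α * gaussianBump α y x) * ∑ i, B x i * (x i - y i) := by
      rw [Finset.mul_sum]
      exact Finset.sum_congr rfl fun i _ => by rw [pderiv_gaussianBump]; ring
    rw [e1, e2, hS]
    ring
  rw [hsum]
  refine mul_lt_mul_of_pos_right ?_ (Real.exp_pos _)
  have hSx : S x ≤ |E| := (le_abs_self _).trans ((hE x ⟨hx2, hx1⟩).trans (le_abs_self E))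
  have hQx := hlQ x ⟨hx2, hx1⟩
  have h3 : 2 * |E| + |K| + 1 ≤ α * Q x := h2.trans (by gcongr)
  have h4 : α * (2 * |E| + |K| + 1) ≤ α * (α * Q x) := by gcongr
  have h5 : α * S x ≤ α * |E| := by gcongr
  have h6 : |K| + 1 ≤ α * (|K| + 1) := le_mul_of_one_le_left (by positivity) h1
  have h7 : 0 ≤ α * |E| := by positivity
  have h8 := le_abs_self K
  have h9 := abs_nonneg K
  nlinarith

/-- The strong maximum principle: a stationary density that vanishes somewhere is zero. -/
theorem IsStationaryDensity.eq_zero_of_apply_eq_zero {p : Space d → ℝ}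
    (hp : X.IsStationaryDensity p) {z₀ : Space d} (hz₀ : p z₀ = 0) (y : Space d) : p y = 0 := by
  by_contra hy
  obtain ⟨hp2, hp0⟩ := hp
  have hpc := hp2.continuous
  have hNc : Continuous (sqDist y) := (contDiff_sqDist (n := 0) y).continuous
  have hZ : IsCompact ({x | sqDist y x ≤ sqDist y z₀} ∩ {x | p x = 0}) :=
    (isCompact_sqDist_le y _).inter_right (isClosed_eq hpc continuous_const)
  -- `z` is a zero of `p` nearest to `y`, so `p > 0` on the open Euclidean ball about `y` reaching
  -- `z`.
  obtain ⟨z, ⟨-, hz⟩, hzmin⟩ := hZ.exists_isMinOn ⟨z₀, le_refl (sqDist y z₀), hz₀⟩ hNc.continuousOn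
  rw [Set.mem_ofPred_eq] at hz
  set T := sqDist y z with hTdef
  have hT : 0 < T := lt_of_le_of_ne (sqDist_nonneg y z) fun h => hy (by
    rw [← sqDist_eq_zero.1 h.symm, hz])
  have hpos : ∀ x, sqDist y x < T → 0 < p x := fun x hx => by
    refine lt_of_le_of_ne (hp0 x).1 fun h => hx.not_ge (hzmin ⟨?_, h.symm⟩)
    exact hx.le.trans (hzmin ⟨le_refl (sqDist y z₀), hz₀⟩)
  obtain ⟨B, c, hB, hc, hexp⟩ := X.exists_forwardOp_eq
  obtain ⟨K, hK⟩ := (isCompact_sqDist_le y T).exists_bound_of_continuousOn hc.continuousOn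
  obtain ⟨α, hα, hbar⟩ := X.exists_barrier hB y hT K
  obtain ⟨m₀, hm₀, hm₀p⟩ : ∃ m₀ > 0, ∀ x, sqDist y x ≤ T / 4 → m₀ ≤ p x := by
    obtain ⟨x, hx, hmin⟩ := (isCompact_sqDist_le y (T / 4)).exists_isMinOn
      ⟨y, by simp only [Set.mem_ofPred_eq, sqDist_eq_zero.2 rfl]; linarith⟩ hpc.continuousOn
    exact ⟨p x, hpos x (lt_of_le_of_lt hx (by linarith)), fun z hz => hmin hz⟩
  set τ := Real.exp (-α * T) with hτ
  have hτ0 : 0 < τ := Real.exp_pos _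
  set δ := m₀ / 2 with hδ
  have hδ0 : 0 < δ := half_pos hm₀
  -- The barrier is shifted to vanish on the sphere through `z`. Outside it the shifted barrier is
  -- negative; where the squared distance is at most `T / 4`, `δ = m₀ / 2` keeps it below `p`. Since
  -- `h z = 0`, a minimum of `h` over the ball of twice the radius lies in the shell, and is
  -- interior to that larger ball.
  set h : Space d → ℝ := fun x => p x - (δ * gaussianBump α y x - δ * τ) with hh
  have hbd : Differentiable ℝ fun x => δ * gaussianBump α y x :=
    (differentiable_gaussianBump α y).const_mul δ
  have hh2 : ContDiff ℝ 2 h :=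
    hp2.sub ((contDiff_const.mul (contDiff_gaussianBump α y)).sub contDiff_const)
  obtain ⟨m, hm, hmin⟩ := (isCompact_sqDist_le y (4 * T)).exists_isMinOn
    ⟨z, show sqDist y z ≤ 4 * T by linarith⟩ hh2.continuous.continuousOn
  have hhz : h z = 0 := by simp [hh, hz, hτ, hTdef, gaussianBump]
  have hhm : h m ≤ 0 := hhz ▸ hmin (show sqDist y z ≤ 4 * T by linarith)
  have hmT : sqDist y m ≤ T := by
    by_contra! hlt
    have : gaussianBump α y m < τ := Real.exp_lt_exp.2 (by nlinarith)
    have := (hp0 m).1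
    have : δ * gaussianBump α y m < δ * τ := by gcongr
    simp only [hh] at hhm
    linarith
  have hmT' : T / 4 ≤ sqDist y m := by
    by_contra! hlt
    have h1 := hm₀p m hlt.le
    have h2 : gaussianBump α y m ≤ 1 :=
      Real.exp_le_one_iff.2 (by nlinarith [sqDist_nonneg y m, mul_nonneg hα.le (sqDist_nonneg y m)])
    have : δ * gaussianBump α y m ≤ δ * 1 := by gcongr
    have : 0 < δ * τ := by positivity
    simp only [hh] at hhm
    linarith
  have hloc : IsLocalMin h m := hmin.isLocalMin <|
    mem_of_superset ((isOpen_lt hNc continuous_const).mem_nhds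
      (show sqDist y m < 4 * T by linarith)) fun x hx => le_of_lt (show sqDist y x < 4 * T from hx)
  have hpd := hp2.differentiable (by simp)
  have hg1 : ∀ i x, pderiv i h x = pderiv i p x - δ * pderiv i (gaussianBump α y) x :=
    fun i x => by
      rw [hh, pderiv_sub (hpd x) ((hbd x).sub_const _), pderiv_sub (hbd x)
        (differentiableAt_const _), pderiv_const_mul _ (differentiable_gaussianBump α y x),
        pderiv_const, sub_zero]
  have hg2 : ∀ i j x, pderiv i (pderiv j h) x =
      pderiv i (pderiv j p) x - δ * pderiv i (pderiv j (gaussianBump α y)) x := fun i j x => by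
    have hdg : Differentiable ℝ (pderiv j (gaussianBump α y)) :=
      (contDiff_one_pderiv (contDiff_gaussianBump α y)).differentiable (by simp)
    rw [funext (hg1 j), pderiv_sub ((contDiff_one_pderiv hp2).differentiable (by simp) x)
      ((hdg x).const_mul δ), pderiv_const_mul _ (hdg x)]
  have hgrad : ∀ i, pderiv i p m = δ * pderiv i (gaussianBump α y) m := fun i => by
    have := hloc.pderiv_eq_zero i
    rw [hg1] at this
    linarith
  have hhess := X.sum_D_mul_pderiv_pderiv_nonneg hh2 hloc
  simp only [hg2, mul_sub, Finset.sum_sub_distrib] at hhess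
  have heq := hexp p hp2 m
  rw [(hp0 m).2] at heq
  have hS1 : ∑ i, B m i * pderiv i p m = δ * ∑ i, B m i * pderiv i (gaussianBump α y) m := by
    rw [Finset.mul_sum]
    exact Finset.sum_congr rfl fun i _ => by rw [hgrad]; ring
  have hS2 : ∑ i, ∑ j, X.D m i j * (δ * pderiv i (pderiv j (gaussianBump α y)) m)
      = δ * ∑ i, ∑ j, X.D m i j * pderiv i (pderiv j (gaussianBump α y)) m := by
    simp only [Finset.mul_sum]
    exact Finset.sum_congr rfl fun i _ => Finset.sum_congr rfl fun j _ => by ring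
  rw [hS1] at heq
  rw [hS2] at hhess
  -- At `m` the stationary equation and the strict barrier inequality give `0 > δ K b + c p` with
  -- `b` the Gaussian. But `c ≥ -K` and `0 ≤ p ≤ δ b` there, a contradiction; no sign of `c` is
  -- needed.
  have hb := mul_lt_mul_of_pos_left (hbar m hmT' hmT) hδ0
  have hcm : -(c m) ≤ K := (neg_le_abs _).trans (hK m hmT)
  have hK0 : 0 ≤ K := (norm_nonneg _).trans (hK m hmT)
  have hpm : p m ≤ δ * gaussianBump α y m := by
    have : 0 < δ * τ := by positivity
    simp only [hh] at hhm
    linarith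
  have h1 : -(c m) * p m ≤ K * p m := mul_le_mul_of_nonneg_right hcm (hp0 m).1
  have h2 : K * p m ≤ K * (δ * gaussianBump α y m) := mul_le_mul_of_nonneg_left hpm hK0
  linarith

lemma IsStationaryDensity.pos {p : Space d → ℝ} (hp : X.IsStationaryDensity p) {y : Space d}
    (hy : p y ≠ 0) (x : Space d) : 0 < p x :=
  lt_of_le_of_ne (hp.2 x).1 fun h => hy (hp.eq_zero_of_apply_eq_zero h.symm y)

end PeriodicDiffusion

end LiftedDiffusion

namespace LiftedDiffusion

variable {d : ℕ}

/-! ### Integration over cubes and integration by parts. -/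

section Integration

lemma closedBall_zero_eq_Icc {R : ℝ} (hR : 0 ≤ R) :
    Metric.closedBall (0 : Space d) R = Set.Icc (fun _ => -R) (fun _ => R) := by
  ext x
  simp only [mem_closedBall_zero_iff, pi_norm_le_iff_of_nonneg hR, Real.norm_eq_abs, abs_le,
    Set.mem_Icc, Pi.le_def, forall_and]

lemma eq_zero_of_forall_setIntegral_closedBall_le {G : Space d → ℝ} (hG : Continuous G)
    (h0 : ∀ x, 0 ≤ G x) (h : ∀ R, 0 ≤ R → ∫ x in Metric.closedBall 0 R, G x ≤ 0) (x : Space d) :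
    G x = 0 := by
  set R := ‖x‖ + 1
  have hint : IntegrableOn G (Metric.closedBall 0 R) :=
    hG.continuousOn.integrableOn_compact (isCompact_closedBall 0 R)
  have hz : ∫ x in Metric.closedBall 0 R, G x = 0 :=
    le_antisymm (h R (by positivity)) (integral_nonneg h0)
  rw [integral_eq_zero_iff_of_nonneg h0 hint] at hz
  exact Measure.eqOn_open_of_ae_eq (μ := volume) (ae_restrict_of_ae_restrict_of_subset
    Metric.ball_subset_closedBall hz) Metric.isOpen_ball hG.continuousOn continuousOn_const
    (by simp [R])

lemma setIntegral_divergence_eq_boundaryFlux {V : Space d → Space d}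
    (hV : ∀ i, ContDiff ℝ 1 fun x => V x i) {R : ℝ} (hR : 0 ≤ R) :
    ∫ x in Set.Icc (fun _ => -R) (fun _ => R), divergence V x = boundaryFlux V R :=
  integral_divergence_of_hasFDerivAt_off_countable' (fun _ => -R) (fun _ => R)
    (fun _ => by linarith) (fun i x => V x i) (fun i x => fderiv ℝ (fun y => V y i) x) ∅
    Set.countable_empty (fun i => (hV i).continuous.continuousOn)
    (fun x _ i => ((hV i).differentiable (by simp) x).hasFDerivAt)
    ((continuous_divergence hV).continuousOn.integrableOn_compact isCompact_Icc)

lemma hasCompactSupport_pderiv {f : Space d → ℝ} (hf : HasCompactSupport f) (i : Fin (d + 1)) :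
    HasCompactSupport (pderiv i f) :=
  hf.fderiv_apply (𝕜 := ℝ) _

lemma integral_mul_pderiv {f g : Space d → ℝ} (hf : ContDiff ℝ 1 f) (hfc : HasCompactSupport f)
    (hg : ContDiff ℝ 1 g) (i : Fin (d + 1)) :
    ∫ x, f x * pderiv i g x = -∫ x, pderiv i f x * g x := by
  refine integral_mul_fderiv_eq_neg_fderiv_mul_of_integrable ?_ ?_ ?_
    (fun x _ => hf.differentiable (by simp) x) (fun x _ => hg.differentiable (by simp) x)
  · exact ((continuous_pderiv hf).mul hg.continuous).integrable_of_hasCompactSupport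
      (hasCompactSupport_pderiv hfc i).mul_right
  · exact (hf.continuous.mul (continuous_pderiv hg)).integrable_of_hasCompactSupport hfc.mul_right
  · exact (hf.continuous.mul hg.continuous).integrable_of_hasCompactSupport hfc.mul_right

lemma integral_mul_divergence {f : Space d → ℝ} {V : Space d → Space d} (hf : ContDiff ℝ 1 f)
    (hfc : HasCompactSupport f) (hV : ∀ i, ContDiff ℝ 1 fun x => V x i) :
    ∫ x, f x * divergence V x = -∑ i, ∫ x, pderiv i f x * V x i := by
  simp only [divergence, Finset.mul_sum]
  have hint : ∀ i, Integrable fun x => f x * pderiv i (fun y => V y i) x := fun i =>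
    (hf.continuous.mul (continuous_pderiv (hV i))).integrable_of_hasCompactSupport hfc.mul_right
  rw [integral_finsetSum _ fun i _ => hint i, Finset.sum_congr rfl fun i _ => integral_mul_pderiv hf hfc (hV i) i, Finset.sum_neg_distrib]

end Integration

/-! ### Periodic functions: boundedness and non-integrability. -/

section Periodic

lemma IsOnePeriodic.exists_abs_le {g : Space d → ℝ} (hg : IsOnePeriodic g) (hc : Continuous g) :
    ∃ C, ∀ x, |g x| ≤ C := by
  obtain ⟨C, hC⟩ := (isCompact_Icc (a := (0 : Space d)) (b := 1)).exists_bound_of_continuousOn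
    hc.continuousOn
  have hsum : ∀ (s : Finset (Fin (d + 1))) (k : Fin (d + 1) → ℤ),
      Function.Periodic g (∑ i ∈ s, k i • Pi.single i (1 : ℝ)) := by
    intro s k
    induction s using Finset.induction_on with
    | empty => simp [Function.Periodic]
    | insert i s hi ih =>
      rw [Finset.sum_insert hi]
      exact (Function.Periodic.zsmul (hg i) (k i)).add_period ih
  refine ⟨C, fun x => ?_⟩
  have hx : (fun i => Int.fract (x i)) + ∑ i, ⌊x i⌋ • Pi.single i (1 : ℝ) = x := by
    ext j
    simp [Finset.sum_apply, Pi.single_apply, Int.fract_add_floor]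
  rw [← hx, hsum]
  exact hC _ ⟨fun i => Int.fract_nonneg _, fun i => (Int.fract_lt_one _).le⟩

lemma pderiv_comp_add_right (i : Fin (d + 1)) (g : Space d → ℝ) (e x : Space d) :
    pderiv i (fun y => g (y + e)) x = pderiv i g (x + e) := by
  simp [pderiv, fderiv_comp_add_right]

lemma divergence_comp_add_right (V : Space d → Space d) (e x : Space d) :
    divergence (fun y => V (y + e)) x = divergence V (x + e) :=
  Finset.sum_congr rfl fun i _ => pderiv_comp_add_right i (fun y => V y i) e x

/-- The reciprocal is also continuous and periodic, hence bounded by some `C`. So `1 ≤ C g`, and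
integrability of `g` would give `ℝⁿ` finite volume. -/
lemma IsOnePeriodic.not_integrable {g : Space d → ℝ} (hg : IsOnePeriodic g) (hc : Continuous g)
    (hpos : ∀ x, 0 < g x) : ¬ Integrable g := by
  intro hint
  have hper : IsOnePeriodic fun x => (g x)⁻¹ := fun i x => congrArg (·⁻¹) (hg i x)
  obtain ⟨C, hC⟩ := hper.exists_abs_le (hc.inv₀ fun x => (hpos x).ne')
  have : Integrable (fun _ : Space d => (1 : ℝ)) := by
    refine (hint.const_mul C).mono' aestronglyMeasurable_const (ae_of_all _ fun x => ?_)
    have h1 := (le_abs_self _).trans (hC x)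
    rw [norm_one, ← inv_mul_cancel₀ (hpos x).ne']
    exact mul_le_mul_of_nonneg_right h1 (hpos x).le
  rw [integrable_const_iff] at this
  rcases this with h | h
  · exact one_ne_zero h
  · exact (measure_lt_top (volume : Measure (Space d)) Set.univ).ne
      (by simp [volume_pi])

end Periodic

/-! ### Stationary densities: translates, sums and dissipation. -/

namespace PeriodicDiffusion

variable {X : PeriodicDiffusion d}

lemma IsStationaryDensity.differentiable {p : Space d → ℝ} (hp : X.IsStationaryDensity p) :
    Differentiable ℝ p := hp.1.differentiable (by simp)

lemma IsStationaryDensity.divergence_J {p : Space d → ℝ} (hp : X.IsStationaryDensity p)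
    (x : Space d) : divergence (X.J p) x = 0 := by
  rw [← forwardOp_eq_divergence_J hp.1, (hp.2 x).2]

lemma forwardOp_comp_add_single (g : Space d → ℝ) (i : Fin (d + 1)) (x : Space d) :
    X.forwardOp (fun y => g (y + Pi.single i 1)) x = X.forwardOp g (x + Pi.single i 1) := by
  have h1 : (fun y => g (y + Pi.single i 1) • X.b y)
      = fun y => (fun z => g z • X.b z) (y + Pi.single i 1) :=
    funext fun y => by simp only [X.periodic_b i y]
  have hD : ∀ y, X.D (y + Pi.single i 1) = X.D y := fun y => by simp [D, X.periodic_Γ i y]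
  have h2 : matrixDivergence (fun y => g (y + Pi.single i 1) • X.D y)
      = fun y => matrixDivergence (fun z => g z • X.D z) (y + Pi.single i 1) := by
    ext y j
    rw [matrixDivergence, matrixDivergence, ← divergence_comp_add_right]
    simp only [hD]
  rw [forwardOp, forwardOp, h1, h2,
    divergence_comp_add_right (fun z => g z • X.b z),
    divergence_comp_add_right (matrixDivergence fun z => g z • X.D z)]

lemma IsStationaryDensity.comp_add_single {p : Space d → ℝ} (hp : X.IsStationaryDensity p)
    (i : Fin (d + 1)) : X.IsStationaryDensity fun x => p (x + Pi.single i 1) :=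
  ⟨hp.1.comp (contDiff_id.add contDiff_const), fun x =>
    ⟨(hp.2 _).1, by rw [forwardOp_comp_add_single, (hp.2 _).2]⟩⟩

lemma IsStationaryDensity.add {p q : Space d → ℝ} (hp : X.IsStationaryDensity p)
    (hq : X.IsStationaryDensity q) : X.IsStationaryDensity fun x => p x + q x := by
  refine ⟨hp.1.add hq.1, fun x => ⟨add_nonneg (hp.2 x).1 (hq.2 x).1, ?_⟩⟩
  have hJ : (fun y => X.J (fun x => p x + q x) y) = fun y => X.J p y + X.J q y := by
    ext y i
    rw [Pi.add_apply, J_eq (hp.differentiable y), J_eq (hq.differentiable y),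
      J_eq ((hp.differentiable y).fun_add (hq.differentiable y)),
      Finset.sum_congr rfl fun j _ => by
        rw [pderiv_add (hp.differentiable y) (hq.differentiable y), mul_add],
      Finset.sum_add_distrib]
    ring
  have h1 := hp.divergence_J x
  have h2 := hq.divergence_J x
  rw [forwardOp_eq_divergence_J (hp.1.add hq.1)]
  calc divergence (fun y => X.J (fun x => p x + q x) y) x
      = divergence (X.J p) x + divergence (X.J q) x := by
        rw [hJ]
        simp only [divergence, Pi.add_apply]
        rw [← Finset.sum_add_distrib]
        exact Finset.sum_congr rfl fun i _ =>
          pderiv_add (differentiable_J hp.1 i x) (differentiable_J hq.1 i x)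
    _ = 0 := by rw [h1, h2, add_zero]

/-- The dissipation `∇u · D ∇u`. -/
noncomputable def dissipation (X : PeriodicDiffusion d) (u : Space d → ℝ) (x : Space d) : ℝ :=
  ∑ i, pderiv i u x * ∑ j, X.D x i j * pderiv j u x

lemma dissipation_nonneg (u : Space d → ℝ) (x : Space d) : 0 ≤ X.dissipation u x :=
  X.sum_D_mul_self_nonneg x fun i => pderiv i u x

lemma exists_eq_const_of_dissipation_eq_zero {u : Space d → ℝ} (hu : Differentiable ℝ u)
    (h : ∀ x, X.dissipation u x = 0) : ∃ c, ∀ x, u x = c :=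
  exists_eq_const_of_pderiv_eq_zero hu fun x i =>
    congrFun (X.eq_zero_of_sum_D_mul_self (v := fun i => pderiv i u x) (h x)) i

/-! ### Ratios of stationary densities and the entropy argument. -/

section Quotient

variable {p m : Space d → ℝ}

lemma IsStationaryDensity.contDiff_div (hp : X.IsStationaryDensity p)
    (hm : X.IsStationaryDensity m) (hpos : ∀ x, 0 < m x) : ContDiff ℝ 2 fun x => p x / m x :=
  hp.1.div hm.1 fun x => (hpos x).ne'

lemma IsStationaryDensity.J_eq_div_mul (hp : X.IsStationaryDensity p)
    (hm : X.IsStationaryDensity m) (hpos : ∀ x, 0 < m x) (x : Space d) (i : Fin (d + 1)) :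
    X.J p x i = p x / m x * X.J m x i
      + m x * ∑ j, X.D x i j * pderiv j (fun x => p x / m x) x := by
  have h := J_mul (X := X) ((hp.contDiff_div hm hpos).differentiable (by simp) x)
    (hm.differentiable x) i
  rwa [show (fun y => p y / m y * m y) = p from
    funext fun y => div_mul_cancel₀ _ (hpos y).ne'] at h

lemma IsStationaryDensity.sum_J_sub_mul_pderiv (hp : X.IsStationaryDensity p)
    (hm : X.IsStationaryDensity m) (hpos : ∀ x, 0 < m x) (x : Space d) :
    ∑ i, X.J p x i * pderiv i (fun x => p x / m x) x
      - p x / m x * ∑ i, X.J m x i * pderiv i (fun x => p x / m x) x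
      = m x * X.dissipation (fun x => p x / m x) x := by
  simp only [dissipation, Finset.mul_sum (s := Finset.univ) (a := p x / m x)]
  rw [← Finset.sum_sub_distrib, Finset.mul_sum]
  exact Finset.sum_congr rfl fun i _ => by rw [hp.J_eq_div_mul hm hpos]; ring

lemma IsStationaryDensity.forwardOp_div_mul_self (hp : X.IsStationaryDensity p)
    (hm : X.IsStationaryDensity m) (hpos : ∀ x, 0 < m x) (x : Space d) :
    X.forwardOp (fun x => p x / m x * p x) x
      = 2 * (m x * X.dissipation (fun x => p x / m x) x) := by
  have hs2 := hp.contDiff_div hm hpos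
  have hs : Differentiable ℝ fun x => p x / m x := hs2.differentiable (by simp)
  have hJp := differentiable_J (X := X) hp.1
  have hJm := differentiable_J (X := X) hm.1
  -- With `s = p/m`, substituting `m D∇s = J_p - s J_m` gives `J_{sp} = s (2 J_p - s J_m)`, whose
  -- divergence is easy because `J_p` and `J_m` are divergence-free.
  have hJ : (fun y => X.J (fun x => p x / m x * p x) y) =
      fun y => (p y / m y) • (fun y i => 2 * X.J p y i - p y / m y * X.J m y i : _ → Space d) y := by
    ext y i
    rw [J_mul (hs y) (hp.differentiable y), Pi.smul_apply, smul_eq_mul]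
    have h := hp.J_eq_div_mul hm hpos y i
    have hpm : p y = p y / m y * m y := (div_mul_cancel₀ _ (hpos y).ne').symm
    rw [show p y * ∑ j, X.D y i j * pderiv j (fun x => p x / m x) y =
      p y / m y * (m y * ∑ j, X.D y i j * pderiv j (fun x => p x / m x) y) by
        rw [← mul_assoc, ← hpm], eq_sub_of_add_eq' h.symm]
    ring
  have hdiv : divergence (fun y i => 2 * X.J p y i - p y / m y * X.J m y i) x
      = -∑ i, X.J m x i * pderiv i (fun x => p x / m x) x := by
    have h1 := hp.divergence_J x
    have h2 := hm.divergence_J x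
    rw [divergence] at h1 h2
    rw [divergence, Finset.sum_congr rfl fun i _ => by
      rw [pderiv_sub ((hJp i x).const_mul 2) ((hs x).fun_mul (hJm i x)),
        pderiv_const_mul _ (hJp i x), pderiv_mul (hs x) (hJm i x)],
      Finset.sum_sub_distrib, Finset.sum_add_distrib, ← Finset.mul_sum, ← Finset.mul_sum, h1, h2]
    ring
  rw [forwardOp_eq_divergence_J (hs2.mul hp.1)]
  change divergence (fun y => X.J (fun x => p x / m x * p x) y) x = _
  rw [hJ, divergence_mul (hs x) fun i => ((hJp i x).const_mul 2).fun_sub ((hs x).fun_mul (hJm i x)),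
    hdiv, ← hp.sum_J_sub_mul_pderiv hm hpos]
  simp only [sub_mul, Finset.sum_sub_distrib, mul_assoc, ← Finset.mul_sum]
  ring

/-- Pointwise entropy production: as `J_p` and `J_m` are divergence-free, only `u⁻¹ J_p·∇u - J_m·∇u`
survives, with `u = p/m`. -/
lemma IsStationaryDensity.divergence_log_sub (hp : X.IsStationaryDensity p)
    (hppos : ∀ x, 0 < p x) (hm : X.IsStationaryDensity m) (hpos : ∀ x, 0 < m x) (x : Space d) :
    divergence (fun x => Real.log (p x / m x) • X.J p x) x
      - divergence (fun x => (p x / m x) • X.J m x) x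
      = m x / (p x / m x) * X.dissipation (fun x => p x / m x) x := by
  have hu : Differentiable ℝ fun x => p x / m x :=
    (hp.contDiff_div hm hpos).differentiable (by simp)
  have hu0 : p x / m x ≠ 0 := (div_pos (hppos x) (hpos x)).ne'
  have hlog : ∀ i, pderiv i (fun x => Real.log (p x / m x)) x
      = (p x / m x)⁻¹ * pderiv i (fun x => p x / m x) x := fun i =>
    pderiv_comp (Real.hasDerivAt_log hu0) (hu x)
  rw [divergence_mul ((hu x).log hu0) fun i => differentiable_J hp.1 i x,
    divergence_mul (hu x) fun i => differentiable_J hm.1 i x, hp.divergence_J, hm.divergence_J,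
    div_mul_eq_mul_div (m x), ← hp.sum_J_sub_mul_pderiv hm hpos, sub_div,
    mul_div_cancel_left₀ _ hu0, mul_zero, mul_zero, zero_add, zero_add, Finset.sum_div]
  congr 1
  exact Finset.sum_congr rfl fun i _ => by rw [hlog]; ring

/-- Uniqueness among stationary densities with vanishing boundary terms. -/
theorem IsStationaryDensity.exists_eq_mul_of_boundaryTermsVanish (hp : X.IsStationaryDensity p)
    (hm : X.IsStationaryDensity m) (hpos : ∀ x, 0 < m x) (hbd : X.BoundaryTermsVanish p m) :
    ∃ c : ℝ, ∀ x, p x = c * m x := by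
  by_cases hz : ∃ y, p y ≠ 0
  swap
  · push Not at hz
    exact ⟨0, fun x => by rw [hz, zero_mul]⟩
  obtain ⟨y, hy⟩ := hz
  have hppos := hp.pos hy
  have hu2 := hp.contDiff_div hm hpos
  have hu1 : ContDiff ℝ 1 fun x => p x / m x := hu2.of_le (by norm_num)
  have hu0 : ∀ x, 0 < p x / m x := fun x => div_pos (hppos x) (hpos x)
  set u : Space d → ℝ := fun x => p x / m x with hu
  have hW1 : ∀ i, ContDiff ℝ 1 fun x => (Real.log (p x / m x) • X.J p x) i := fun i =>
    (hu1.log fun x => (hu0 x).ne').mul (contDiff_J hp.1 i)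
  have hW2 : ∀ i, ContDiff ℝ 1 fun x => ((p x / m x) • X.J m x) i := fun i =>
    hu1.mul (contDiff_J hm.1 i)
  set G : Space d → ℝ := fun x => m x / (p x / m x) * X.dissipation u x with hG
  have hGeq : ∀ x, G x = divergence (fun x => Real.log (p x / m x) • X.J p x) x
      - divergence (fun x => (p x / m x) • X.J m x) x := fun x =>
    (hp.divergence_log_sub hppos hm hpos x).symm
  have hG0 : ∀ x, 0 ≤ G x := fun x =>
    mul_nonneg (div_pos (hpos x) (hu0 x)).le (dissipation_nonneg u x)
  have hGc : Continuous G := by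
    rw [funext hGeq]
    exact (continuous_divergence hW1).sub (continuous_divergence hW2)
  have hint : ∀ {H : Space d → ℝ}, Continuous H → ∀ R : ℝ,
      IntegrableOn H (Set.Icc (fun _ => -R) (fun _ => R)) := fun hH R =>
    hH.continuousOn.integrableOn_compact isCompact_Icc
  have hflux : ∀ R, 0 ≤ R → ∫ x in Set.Icc (fun _ => -R) (fun _ => R), G x =
      boundaryFlux (fun x => Real.log (p x / m x) • X.J p x) R
        - boundaryFlux (fun x => (p x / m x) • X.J m x) R := fun R hR => by
    rw [← setIntegral_divergence_eq_boundaryFlux hW1 hR,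
      ← setIntegral_divergence_eq_boundaryFlux hW2 hR, ← integral_sub
        (hint (continuous_divergence hW1) R) (hint (continuous_divergence hW2) R)]
    simp only [hGeq]
  have hGz : ∀ x, G x = 0 := by
    -- Sup-norm balls are cubes. As `G ≥ 0`, its integral over a fixed cube is at most that over any
    -- larger one, and these tend to `0`.
    refine eq_zero_of_forall_setIntegral_closedBall_le hGc hG0 fun R₀ hR₀ => ?_
    have hlim := hbd.1.sub hbd.2
    rw [sub_zero] at hlim
    refine ge_of_tendsto hlim ?_
    filter_upwards [eventually_ge_atTop R₀] with R hR
    rw [← hflux R (hR₀.trans hR), ← closedBall_zero_eq_Icc (hR₀.trans hR)]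
    refine setIntegral_mono_set ?_ (ae_of_all _ hG0)
      (Metric.closedBall_subset_closedBall hR).eventuallyLE
    rw [closedBall_zero_eq_Icc (hR₀.trans hR)]
    exact hint hGc R
  obtain ⟨c, hc⟩ := exists_eq_const_of_dissipation_eq_zero (X := X)
    (hu2.differentiable (by simp)) fun x =>
      (mul_eq_zero.1 (hGz x)).resolve_left (div_pos (hpos x) (hu0 x)).ne'
  exact ⟨c, fun x => (div_eq_iff (hpos x).ne').1 (hc x)⟩

end Quotient

end PeriodicDiffusion

end LiftedDiffusion

/-! ### Integrable stationary densities: cutoffs, rigidity and non-existence. -/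

namespace LiftedDiffusion

variable {d : ℕ}

lemma pderiv_comp_smul (i : Fin (d + 1)) {g : Space d → ℝ} (hg : Differentiable ℝ g) (c : ℝ)
    (x : Space d) : pderiv i (fun y => g (c • y)) x = c * pderiv i g (c • x) := by
  have h : HasFDerivAt (fun y : Space d => c • y) (c • ContinuousLinearMap.id ℝ (Space d)) x :=
    (hasFDerivAt_id x).const_smul c
  have h' := ((hg (c • x)).hasFDerivAt.comp x h).fderiv
  simp only [Function.comp_def] at h'
  simp [pderiv, h']

namespace PeriodicDiffusion

variable {X : PeriodicDiffusion d}

/-- The backward operator `χ ↦ D : ∇²χ + b · ∇χ`, the adjoint of the forward operator. -/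
noncomputable def backwardOp (X : PeriodicDiffusion d) (χ : Space d → ℝ) (x : Space d) : ℝ :=
  ∑ i, ∑ j, X.D x i j * pderiv j (pderiv i χ) x + ∑ i, X.b x i * pderiv i χ x

lemma integral_mul_forwardOp {F χ : Space d → ℝ} (hF : ContDiff ℝ 2 F) (hχ : ContDiff ℝ 2 χ)
    (hχc : HasCompactSupport χ) :
    ∫ x, χ x * X.forwardOp F x = ∫ x, X.backwardOp χ x * F x := by
  have hχ1 : ContDiff ℝ 1 χ := hχ.of_le (by norm_num)
  have hF1 : ContDiff ℝ 1 F := hF.of_le (by norm_num)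
  have hFD : ∀ i j, ContDiff ℝ 1 fun x => F x * X.D x i j := fun i j =>
    hF1.mul ((X.contDiff_D i j).of_le (by simp))
  have hi1 : ∀ i j, Integrable fun x => pderiv i χ x * pderiv j (fun y => F y * X.D y i j) x :=
    fun i j => ((continuous_pderiv hχ1).mul
      (continuous_pderiv (hFD i j))).integrable_of_hasCompactSupport
        (hasCompactSupport_pderiv hχc i).mul_right
  have hi2 : ∀ i j, Integrable fun x => pderiv j (pderiv i χ) x * (F x * X.D x i j) :=
    fun i j => ((continuous_pderiv (contDiff_one_pderiv hχ)).mul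
      (hFD i j).continuous).integrable_of_hasCompactSupport
        (hasCompactSupport_pderiv (hasCompactSupport_pderiv hχc i) j).mul_right
  have hi3 : ∀ i, Integrable fun x => pderiv i χ x * (F x * X.b x i) := fun i =>
    ((continuous_pderiv hχ1).mul (hF1.continuous.mul
      (X.contDiff_b i).continuous)).integrable_of_hasCompactSupport
        (hasCompactSupport_pderiv hχc i).mul_right
  have key : ∀ i, ∫ x, pderiv i χ x * X.J F x i =
      -(∑ j, ∫ x, pderiv j (pderiv i χ) x * (F x * X.D x i j))
        - ∫ x, pderiv i χ x * (F x * X.b x i) := fun i => by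
    simp only [J_apply, mul_sub, Finset.mul_sum]
    rw [integral_sub (integrable_finsetSum _ fun j _ => hi1 i j) (hi3 i),
      integral_finsetSum _ fun j _ => hi1 i j, ← Finset.sum_neg_distrib]
    congr 1
    exact Finset.sum_congr rfl fun j _ => integral_mul_pderiv (contDiff_one_pderiv hχ)
      (hasCompactSupport_pderiv hχc i) (hFD i j) j
  have hback : ∀ x, X.backwardOp χ x * F x =
      ∑ i, ((∑ j, pderiv j (pderiv i χ) x * (F x * X.D x i j)) + pderiv i χ x * (F x * X.b x i)) :=
    fun x => by
      rw [backwardOp, ← Finset.sum_add_distrib, Finset.sum_mul]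
      refine Finset.sum_congr rfl fun i _ => ?_
      rw [add_mul, Finset.sum_mul]
      congr 1
      · exact Finset.sum_congr rfl fun j _ => by ring
      · ring
  have hi4 : ∀ i, Integrable fun x =>
      (∑ j, pderiv j (pderiv i χ) x * (F x * X.D x i j)) + pderiv i χ x * (F x * X.b x i) :=
    fun i => (integrable_finsetSum _ fun j _ => hi2 i j).add (hi3 i)
  simp only [forwardOp_eq_divergence_J hF, hback]
  rw [integral_mul_divergence hχ1 hχc (contDiff_J hF), Finset.sum_congr rfl fun i _ => key i,
    integral_finsetSum _ fun i _ => hi4 i,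
    ← Finset.sum_neg_distrib]
  refine Finset.sum_congr rfl fun i _ => ?_
  rw [integral_add (integrable_finsetSum _ fun j _ => hi2 i j) (hi3 i),
    integral_finsetSum _ fun j _ => hi2 i j]
  ring

variable (X) in
/-- The backward operator is small on slowly varying test functions. -/
lemma exists_abs_backwardOp_comp_smul_le {χ : Space d → ℝ} (hχ : ContDiff ℝ 2 χ)
    (hχc : HasCompactSupport χ) : ∃ C, ∀ R : ℝ, 1 ≤ R → ∀ x,
      |X.backwardOp (fun y => χ (R⁻¹ • y)) x| ≤ R⁻¹ * C := by
  have hperD : ∀ i j, IsOnePeriodic fun x => X.D x i j := fun i j k x => by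
    simp [D, X.periodic_Γ k x]
  choose M hM using fun i j => (hperD i j).exists_abs_le (X.contDiff_D i j).continuous
  choose M' hM' using fun i : Fin (d + 1) => IsOnePeriodic.exists_abs_le (g := fun x => X.b x i)
    (fun k x => by simp only [X.periodic_b k x]) (X.contDiff_b i).continuous
  have hχ1 : ContDiff ℝ 1 χ := hχ.of_le (by norm_num)
  have hd : ∀ i, Differentiable ℝ (pderiv i χ) := fun i =>
    (contDiff_one_pderiv hχ).differentiable (by simp)
  choose N hN using fun i j => (hasCompactSupport_pderiv (hasCompactSupport_pderiv hχc i)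
    j).exists_bound_of_continuous (continuous_pderiv (contDiff_one_pderiv hχ))
  choose N' hN' using fun i => (hasCompactSupport_pderiv hχc i).exists_bound_of_continuous
    (continuous_pderiv hχ1)
  refine ⟨∑ i, ∑ j, M i j * N i j + ∑ i, M' i * N' i, fun R hR x => ?_⟩
  have hR0 : 0 < R⁻¹ := by positivity
  -- Second derivatives of the rescaled cutoff carry `R⁻²`; for `R ≥ 1` one factor is discarded,
  -- leaving a common `R⁻¹`.
  have hR1 : R⁻¹ ≤ 1 := inv_le_one_of_one_le₀ hR
  have h1 : ∀ i y, pderiv i (fun y => χ (R⁻¹ • y)) y = R⁻¹ * pderiv i χ (R⁻¹ • y) := fun i y =>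
    pderiv_comp_smul i (hχ1.differentiable (by simp)) _ y
  have h2 : ∀ i j y, pderiv j (pderiv i fun y => χ (R⁻¹ • y)) y
      = R⁻¹ * (R⁻¹ * pderiv j (pderiv i χ) (R⁻¹ • y)) := fun i j y => by
    rw [funext (h1 i), pderiv_const_mul, pderiv_comp_smul j (hd i)]
    exact (hd i).comp (differentiable_id.const_smul R⁻¹) y
  have hsum : X.backwardOp (fun y => χ (R⁻¹ • y)) x = R⁻¹ *
      (∑ i, ∑ j, X.D x i j * (R⁻¹ * pderiv j (pderiv i χ) (R⁻¹ • x))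
        + ∑ i, X.b x i * pderiv i χ (R⁻¹ • x)) := by
    simp only [backwardOp, h1, h2, mul_add, Finset.mul_sum]
    congr 1
    · exact Finset.sum_congr rfl fun i _ => Finset.sum_congr rfl fun j _ => by ring
    · exact Finset.sum_congr rfl fun i _ => by ring
  rw [hsum, abs_mul, abs_of_pos hR0]
  refine mul_le_mul_of_nonneg_left ((abs_add_le _ _).trans (add_le_add ?_ ?_)) hR0.le
  · refine (Finset.abs_sum_le_sum_abs _ _).trans (Finset.sum_le_sum fun i _ => ?_)
    refine (Finset.abs_sum_le_sum_abs _ _).trans (Finset.sum_le_sum fun j _ => ?_)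
    rw [abs_mul]
    refine mul_le_mul (hM i j x) ?_ (abs_nonneg _) ((abs_nonneg _).trans (hM i j x))
    rw [abs_mul, abs_of_pos hR0]
    exact (mul_le_of_le_one_left (abs_nonneg _) hR1).trans (hN i j _)
  · refine (Finset.abs_sum_le_sum_abs _ _).trans (Finset.sum_le_sum fun i _ => ?_)
    rw [abs_mul]
    exact mul_le_mul (hM' i x) (hN' i _) (abs_nonneg _) ((abs_nonneg _).trans (hM' i x))

/-- An integrable subsolution of the stationary forward equation is a solution. -/
theorem forwardOp_eq_zero_of_nonneg_of_integrable {F : Space d → ℝ} (hF : ContDiff ℝ 2 F)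
    (hint : Integrable F) (h0 : ∀ x, 0 ≤ X.forwardOp F x) (x : Space d) : X.forwardOp F x = 0 := by
  have hc : Continuous (X.forwardOp F) := continuous_forwardOp hF
  let χ : ContDiffBump (0 : Space d) := ⟨1, 2, one_pos, one_lt_two⟩
  obtain ⟨C, hC⟩ := X.exists_abs_backwardOp_comp_smul_le (χ := χ) χ.contDiff χ.hasCompactSupport
  refine eq_zero_of_forall_setIntegral_closedBall_le hc h0 (fun R₀ _ => ?_) x
  have hlim : Tendsto (fun R : ℝ => R⁻¹ * (C * ∫ x, |F x|)) atTop (𝓝 0) := by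
    simpa using tendsto_inv_atTop_zero.mul_const (C * ∫ x, |F x|)
  refine ge_of_tendsto hlim ?_
  filter_upwards [eventually_ge_atTop R₀, eventually_ge_atTop 1] with R hR hR1
  have hR0 : 0 < R := by linarith
  have hχR : ContDiff ℝ 2 fun y => χ (R⁻¹ • y) := χ.contDiff.comp (contDiff_id.const_smul _)
  have hχRc : HasCompactSupport fun y => χ (R⁻¹ • y) :=
    χ.hasCompactSupport.comp_smul (inv_ne_zero hR0.ne')
  have hprod : Integrable fun y => χ (R⁻¹ • y) * X.forwardOp F y :=
    (hχR.continuous.mul hc).integrable_of_hasCompactSupport hχRc.mul_right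
  calc ∫ y in Metric.closedBall 0 R₀, X.forwardOp F y
      = ∫ y in Metric.closedBall 0 R₀, χ (R⁻¹ • y) * X.forwardOp F y := by
        refine setIntegral_congr_fun Metric.isClosed_closedBall.measurableSet fun y hy => ?_
        rw [mem_closedBall_zero_iff] at hy
        have : χ (R⁻¹ • y) = 1 := χ.one_of_mem_closedBall (by
          rw [mem_closedBall_zero_iff, norm_smul, norm_inv, Real.norm_of_nonneg hR0.le]
          exact inv_mul_le_one_of_le₀ (hy.trans hR) hR0.le)
        simp only [this, one_mul]
    _ ≤ ∫ y, χ (R⁻¹ • y) * X.forwardOp F y :=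
        setIntegral_le_integral hprod (ae_of_all _ fun y => mul_nonneg χ.nonneg (h0 y))
    _ = ∫ y, X.backwardOp (fun y => χ (R⁻¹ • y)) y * F y :=
        integral_mul_forwardOp hF hχR hχRc
    _ ≤ ∫ y, R⁻¹ * C * |F y| := by
        refine (le_abs_self _).trans (norm_integral_le_of_norm_le (f := fun y =>
          X.backwardOp (fun y => χ (R⁻¹ • y)) y * F y) (hint.abs.const_mul (R⁻¹ * C))
          (ae_of_all _ fun y => ?_))
        rw [Real.norm_eq_abs, abs_mul]
        exact mul_le_mul_of_nonneg_right (hC R hR1 y) (abs_nonneg _)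
    _ = R⁻¹ * (C * ∫ x, |F x|) := by rw [integral_const_mul, mul_assoc]

/-- Two integrable stationary densities of the same positive mass coincide. -/
theorem IsStationaryDensity.eq_of_integral_eq {p q : Space d → ℝ} (hp : X.IsStationaryDensity p)
    (hq : X.IsStationaryDensity q) (hpi : Integrable p) (hqi : Integrable q)
    (hpos : ∀ x, 0 < p x) (hpq : ∫ x, p x = ∫ x, q x) (x : Space d) : p x = q x := by
  -- Comparing `p` with `p + q` rather than with `q` keeps the ratio at most `1`, so that `p² / (p +
  -- q)` is integrable.
  have hm := hp.add hq
  have hmpos : ∀ x, 0 < p x + q x := fun x => add_pos_of_pos_of_nonneg (hpos x) (hq.2 x).1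
  have hs2 := hp.contDiff_div hm hmpos
  have hF2 : ContDiff ℝ 2 fun x => p x / (p x + q x) * p x := hs2.mul hp.1
  have hle : ∀ x, p x / (p x + q x) ≤ 1 := fun x =>
    div_le_one_of_le₀ (by linarith [(hq.2 x).1]) (hmpos x).le
  have hFi : Integrable fun x => p x / (p x + q x) * p x := by
    refine hpi.mono' hF2.continuous.aestronglyMeasurable (ae_of_all _ fun x => ?_)
    rw [Real.norm_of_nonneg (mul_nonneg (div_pos (hpos x) (hmpos x)).le (hpos x).le)]
    exact mul_le_of_le_one_left (hpos x).le (hle x)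
  have hform := hp.forwardOp_div_mul_self hm hmpos
  have hzero := forwardOp_eq_zero_of_nonneg_of_integrable (X := X) hF2 hFi fun x => by
    rw [hform]
    exact mul_nonneg two_pos.le (mul_nonneg (hmpos x).le (dissipation_nonneg _ x))
  obtain ⟨c, hc⟩ := exists_eq_const_of_dissipation_eq_zero (X := X)
    (hs2.differentiable (by simp)) fun x => by
      have h := hzero x
      rw [hform] at h
      exact (mul_eq_zero.1 ((mul_eq_zero.1 h).resolve_left two_ne_zero)).resolve_left (hmpos x).ne'
  have hpc : ∀ x, p x = c * (p x + q x) := fun x => (div_eq_iff (hmpos x).ne').1 (hc x)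
  have hmass : ∫ x, p x = c * ((∫ x, p x) + ∫ x, q x) := by
    rw [← integral_add hpi hqi, ← integral_const_mul]
    exact integral_congr_ae (ae_of_all _ hpc)
  have hp0 : 0 < ∫ x, p x := by
    refine (integral_pos_iff_support_of_nonneg (fun x => (hpos x).le) hpi).2 ?_
    rw [show Function.support p = Set.univ from
      Set.eq_univ_of_forall fun x => (hpos x).ne']
    exact isOpen_univ.measure_pos _ Set.univ_nonempty
  rw [← hpq] at hmass
  have hc2 : c = 1 / 2 := by
    have : (∫ x, p x) * (1 - 2 * c) = 0 := by linarith
    rcases mul_eq_zero.1 this with h | h <;> linarith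
  have := hpc x
  rw [hc2] at this
  linarith

/-- No nonzero stationary density is integrable. -/
theorem IsStationaryDensity.not_integrable {p : Space d → ℝ} (hp : X.IsStationaryDensity p)
    {y : Space d} (hy : p y ≠ 0) : ¬ Integrable p := by
  intro hpi
  have hpos := hp.pos hy
  have hper : IsOnePeriodic p := fun i x =>
    (hp.eq_of_integral_eq (hp.comp_add_single i) hpi (hpi.comp_add_right _) hpos
      (integral_add_right_eq_self p _).symm x).symm
  exact hper.not_integrable hp.1.continuous hpos hpi

/-- Densities of one measure agree almost everywhere, hence everywhere by continuity. So `f` is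
constant in time, its time derivative vanishes, and `f 1` is an integrable nonzero stationary
density. -/
theorem not_isStationaryMeasure (μ : Measure (Space d)) [IsProbabilityMeasure μ] :
    ¬ X.IsStationaryMeasure μ := by
  rintro ⟨f, hf, hμ⟩
  have hcont : ∀ t, 0 < t → Continuous (f t) := fun t ht => (hf t ht).1.continuous
  have hmeas : ∀ t, 0 < t → AEMeasurable (fun x => ENNReal.ofReal (f t x)) volume := fun t ht =>
    (hcont t ht).measurable.ennreal_ofReal.aemeasurable
  have hmass : ∫⁻ x, ENNReal.ofReal (f 1 x) = 1 := by
    rw [← setLIntegral_univ, ← withDensity_apply _ MeasurableSet.univ, hμ 1 one_pos, measure_univ]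
  have heq : ∀ t, 0 < t → f t = f 1 := fun t ht => by
    have hae := (withDensity_eq_iff_of_sigmaFinite (hmeas t ht) (hmeas 1 one_pos)).1
      ((hμ t ht).trans (hμ 1 one_pos).symm)
    refine Measure.eq_of_ae_eq (μ := volume) ?_ (hcont t ht) (hcont 1 one_pos)
    filter_upwards [hae] with x hx
    rwa [ENNReal.ofReal_eq_ofReal_iff ((hf t ht).2 x).1 ((hf 1 one_pos).2 x).1] at hx
  have hp : X.IsStationaryDensity (f 1) := by
    refine ⟨(hf 1 one_pos).1, fun x => ⟨((hf 1 one_pos).2 x).1, ?_⟩⟩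
    refine ((hf 1 one_pos).2 x).2.unique ((hasDerivAt_const (1 : ℝ) (f 1 x)).congr_of_eventuallyEq ?_)
    filter_upwards [lt_mem_nhds (one_pos : (0 : ℝ) < 1)] with t ht
    rw [heq t ht]
  have hint : Integrable (f 1) := by
    refine ⟨(hcont 1 one_pos).aestronglyMeasurable, ?_⟩
    rw [hasFiniteIntegral_iff_ofReal (ae_of_all _ fun x => (hp.2 x).1), hmass]
    exact ENNReal.one_lt_top
  have hne : ∃ y, f 1 y ≠ 0 := by
    by_contra! h
    simp [h] at hmass
  obtain ⟨y, hy⟩ := hne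
  exact hp.not_integrable hy hint

lemma IsPeriodicStationaryDensity.pos {ρ : Space d → ℝ} (hρ : X.IsPeriodicStationaryDensity ρ)
    (x : Space d) : 0 < ρ x := by
  obtain ⟨hs, -, hmass⟩ := hρ
  have hne : ∃ y, ρ y ≠ 0 := by
    by_contra! h
    simp [h] at hmass
  obtain ⟨y, hy⟩ := hne
  exact hs.pos hy x

end PeriodicDiffusion

end LiftedDiffusion

theorem mainTheorem11 (d : ℕ) (X : PeriodicDiffusion d) :
    (¬ ∃ μ : Measure (Space d), IsProbabilityMeasure μ ∧ X.IsStationaryMeasure μ) ∧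
    (∀ ρ : Space d → ℝ, X.IsPeriodicStationaryDensity ρ →
      (¬ Integrable ρ volume) ∧
      (∀ p : Space d → ℝ, X.IsStationaryDensity p → X.BoundaryTermsVanish p ρ →
        ∃ c : ℝ, ∀ x, p x = c * ρ x)) := by
  refine ⟨fun ⟨μ, _, hμ⟩ => PeriodicDiffusion.not_isStationaryMeasure μ hμ, fun ρ hρ => ⟨?_, ?_⟩⟩
  · exact hρ.2.1.not_integrable hρ.1.1.continuous hρ.pos
  · exact fun p hp hbd => hp.exists_eq_mul_of_boundaryTermsVanish hρ.1 hρ.pos hbd
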